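/- Let $P_{0,\rho}(x)=1$ and, for $n\ge1$, $P_{n,\rho}(x)=\bigl(nx+\rho(1-x)\bigr)P_{n-1,\rho}(x)+x(1-x)P_{n-1,\rho}'(x)$ be the Euler–Frobenius polynomials, and write $P_{n,\rho}(x)=\sum_{k=0}^n A_{n,k,\rho}x^k$. For $0\le\rho\le1$ the numbers $A_{n,k,\rho}/n!$, $0\le k\le n$, form a probability distribution on $\{0,\dots,n\}$. For arbitrary $\rho\in\mathbb R$, the Euler–Frobenius distribution with parameters $n,\rho$ is the distribution of $E-\lfloor\rho\rfloor$, where $\mathbb P(E=k)=A_{n,k,\{\rho\}}/n!$ for $0\le k\le n$ and $\{\rho\}=\rho-\lfloor\rho\rfloor$. **Theorem.** Let $n\ge1$ and $\rho\in\mathbb R$, and let $Z_{n,\rho}$ be an integer-valued random variable with the Euler–Frobenius distribution with parameters $n,\rho$. The characteristic function of $Z_{n,\rho}$ is given, for $t\in\mathbb R$, by $$\mathbb E\,e^{itZ_{n,\rho}}=i^{-n-1}e^{-i\rho t}\bigl(e^{it}-1\bigr)^{n+1}\sum_{k=-\infty}^{\infty}\frac{e^{-2\pi ik\rho}}{(t+2\pi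 k)^{n+1}}.$$ Equivalently, the moment generating function is, for all $t\in\mathbb C$, $$\mathbb E\,e^{tZ_{n,\rho}}=e^{-\rho t}\bigl(e^{t}-1\bigr)^{n+1}\sum_{k=-\infty}^{\infty}\frac{e^{-2\pi ik\rho}}{(t+2\pi ki)^{n+1}}.$$ The series converge absolutely for $t\notin2\pi\mathbb Z$ and $t\notin2\pi i\mathbb Z$, respectively. For $t\in2\pi\mathbb Z$, respectively $t\in2\pi i\mathbb Z$, the right-hand sides are interpreted by continuity, i.e. as their limits along real, respectively complex, arguments tending to $t$ and different from $t$. -/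

import Mathlib

open Complex MeasureTheory ProbabilityTheory Filter Topology Polynomial

/-- The Euler--Frobenius polynomial `P_{n,ρ}`, defined by `P_{0,ρ} = 1` and
`P_{n,ρ}(x) = (n x + ρ (1 - x)) P_{n-1,ρ}(x) + x (1 - x) P_{n-1,ρ}'(x)` for `n ≥ 1`. -/
noncomputable def eulerFrobeniusPoly (ρ : ℝ) : ℕ → ℝ[X]
  | 0 => 1
  | n + 1 =>
      (C ((n : ℝ) + 1) * X + C ρ * (1 - X)) * eulerFrobeniusPoly ρ n
        + X * (1 - X) * derivative (eulerFrobeniusPoly ρ n)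

/-- The Euler--Frobenius number `A_{n,k,ρ}`, the coefficient of `x ^ k` in `P_{n,ρ}(x)`. -/
noncomputable def eulerFrobeniusNumber (n k : ℕ) (ρ : ℝ) : ℝ :=
  (eulerFrobeniusPoly ρ n).coeff k

theorem eulerFrobeniusNumber_succ_zero (n : ℕ) (ρ : ℝ) :
    eulerFrobeniusNumber (n + 1) 0 ρ = ρ * eulerFrobeniusNumber n 0 ρ := by
  simp [eulerFrobeniusNumber, eulerFrobeniusPoly, mul_coeff_zero]

theorem eulerFrobeniusNumber_succ_succ (n k : ℕ) (ρ : ℝ) :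
    eulerFrobeniusNumber (n + 1) (k + 1) ρ =
      ((k : ℝ) + 1 + ρ) * eulerFrobeniusNumber n (k + 1) ρ
        + ((n : ℝ) + 1 - k - ρ) * eulerFrobeniusNumber n k ρ := by
  have h : eulerFrobeniusPoly ρ (n + 1) =
      C ((n : ℝ) + 1 - ρ) * (X * eulerFrobeniusPoly ρ n) + C ρ * eulerFrobeniusPoly ρ n
        + X * derivative (eulerFrobeniusPoly ρ n)
        - X * (X * derivative (eulerFrobeniusPoly ρ n)) := by
    rw [eulerFrobeniusPoly]
    simp only [C_sub, C_add]
    ring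
  unfold eulerFrobeniusNumber
  rw [h]
  simp only [coeff_add, coeff_sub, coeff_C_mul, coeff_X_mul, coeff_derivative]
  cases k with
  | zero => simp; ring
  | succ j => simp only [coeff_X_mul, coeff_derivative]; push_cast; ring

theorem eulerFrobeniusNumber_eq_zero (n k : ℕ) (ρ : ℝ) (h : n < k) :
    eulerFrobeniusNumber n k ρ = 0 := by
  induction n generalizing k with
  | zero => simp [eulerFrobeniusNumber, eulerFrobeniusPoly, coeff_one]; omega
  | succ n ih =>
    obtain ⟨k, rfl⟩ : ∃ j, k = j + 1 := ⟨k - 1, by omega⟩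
    rw [eulerFrobeniusNumber_succ_succ, ih _ (by omega), ih _ (by omega)]
    simp

theorem eulerFrobeniusNumber_nonneg (n k : ℕ) {ρ : ℝ} (h0 : 0 ≤ ρ) (h1 : ρ ≤ 1) :
    0 ≤ eulerFrobeniusNumber n k ρ := by
  induction n generalizing k with
  | zero =>
    simp only [eulerFrobeniusNumber, eulerFrobeniusPoly, coeff_one]
    split_ifs <;> norm_num
  | succ n ih =>
    cases k with
    | zero =>
      rw [eulerFrobeniusNumber_succ_zero]
      exact mul_nonneg h0 (ih 0)
    | succ k =>
      rw [eulerFrobeniusNumber_succ_succ]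
      refine add_nonneg (mul_nonneg (by positivity) (ih _)) ?_
      rcases lt_or_ge n k with hk | hk
      · rw [eulerFrobeniusNumber_eq_zero n k ρ hk]; simp
      · have : (k : ℝ) ≤ n := by exact_mod_cast hk
        exact mul_nonneg (by linarith) (ih _)

theorem sum_eulerFrobeniusNumber (n : ℕ) (ρ : ℝ) :
    ∑ k ∈ Finset.range (n + 1), eulerFrobeniusNumber n k ρ = (n.factorial : ℝ) := by
  have hd : (eulerFrobeniusPoly ρ n).natDegree < n + 1 :=
    Nat.lt_succ_of_le (natDegree_le_iff_coeff_eq_zero.2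
      fun k hk => eulerFrobeniusNumber_eq_zero n k ρ hk)
  have he : (eulerFrobeniusPoly ρ n).eval 1 = (n.factorial : ℝ) := by
    clear hd
    induction n with
    | zero => simp [eulerFrobeniusPoly]
    | succ n ih => simp [eulerFrobeniusPoly, ih, Nat.factorial_succ]
  rw [← he, eval_eq_sum_range' hd]
  simp [eulerFrobeniusNumber]

/-- For `0 ≤ ρ ≤ 1`, the probability distribution on `{0, …, n}` giving mass `A_{n,k,ρ} / n!`
to `k`. -/
noncomputable def eulerFrobeniusPMFUnit (n : ℕ) (ρ : ℝ) (h0 : 0 ≤ ρ) (h1 : ρ ≤ 1) : PMF ℕ :=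
  PMF.ofFinset
    (fun k => ENNReal.ofReal (eulerFrobeniusNumber n k ρ / (n.factorial : ℝ)))
    (Finset.range (n + 1))
    (by
      rw [← ENNReal.ofReal_sum_of_nonneg
        (fun k _ => div_nonneg (eulerFrobeniusNumber_nonneg n k h0 h1) (by positivity)),
        ← Finset.sum_div, sum_eulerFrobeniusNumber, div_self (by positivity), ENNReal.ofReal_one])
    (by
      intro k hk
      rw [eulerFrobeniusNumber_eq_zero n k ρ (by simpa using hk)]
      simp)

/-- The Euler--Frobenius distribution with parameters `n` and `ρ`, for every real `ρ`: the
distribution of `E - ⌊ρ⌋`, where `E` takes the value `k ∈ {0, …, n}` with probability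
`A_{n,k,{ρ}} / n!` and `{ρ}` is the fractional part of `ρ`. -/
noncomputable def eulerFrobeniusPMF (n : ℕ) (ρ : ℝ) : PMF ℤ :=
  (eulerFrobeniusPMFUnit n (Int.fract ρ) (Int.fract_nonneg ρ) (Int.fract_lt_one ρ).le).map
    (fun k : ℕ => (k : ℤ) - ⌊ρ⌋)

/-- The `k`-th term of the series for the characteristic function. -/
noncomputable def charFunTerm (n : ℕ) (ρ : ℝ) (t : ℂ) (k : ℤ) : ℂ :=
  exp (-(2 * Real.pi * I * k * ρ)) / (t + 2 * Real.pi * k) ^ (n + 1)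

/-- `i^{-n-1} e^{-iρt} (e^{it} - 1)^{n+1} ∑_{k ∈ ℤ} e^{-2πikρ} / (t + 2πk)^{n+1}`. -/
noncomputable def charFunFormula (n : ℕ) (ρ : ℝ) (t : ℂ) : ℂ :=
  (I ^ (n + 1))⁻¹ * exp (-(I * ρ * t)) * (exp (I * t) - 1) ^ (n + 1) * ∑' k : ℤ, charFunTerm n ρ t k

/-- The `k`-th term of the series for the moment generating function. -/
noncomputable def mgfTerm (n : ℕ) (ρ : ℝ) (t : ℂ) (k : ℤ) : ℂ :=
  exp (-(2 * Real.pi * I * k * ρ)) / (t + 2 * Real.pi * k * I) ^ (n + 1)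

/-- `e^{-ρt} (e^t - 1)^{n+1} ∑_{k ∈ ℤ} e^{-2πikρ} / (t + 2πki)^{n+1}`. -/
noncomputable def mgfFormula (n : ℕ) (ρ : ℝ) (t : ℂ) : ℂ :=
  exp (-(ρ * t)) * (exp t - 1) ^ (n + 1) * ∑' k : ℤ, mgfTerm n ρ t k

/-! Put u = {ρ}. Off the poles everything reduces to n! ∑ₖ e^{-2πiku} / (t + 2πik)^{n+1} =
P_{n,u}(e^t) e^{ut} / (e^t - 1)^{n+1} (`factorial_mul_tsum_mgfTerm`), by induction on n. For n = 1
this is the Fourier expansion in u of the right-hand side (`tsum_mgfTerm_one`). Differentiating both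
sides in t carries n to n + 1, because the recurrence for P is exactly what differentiation does to
the closed form.

Replacing u by ρ leaves the series unchanged, and the prefactor e^{-ρt} then produces the shift by
⌊ρ⌋. The characteristic function is the case of argument it. At the poles, the expectation is a
finite sum of exponentials, hence continuous, and so gives the limits. -/

/-! ### Expectations as finite sums -/

theorem integrable_and_integral_eulerFrobeniusPMFUnit (n : ℕ) (ρ : ℝ) (h0 : 0 ≤ ρ) (h1 : ρ ≤ 1)
    (f : ℕ → ℂ) :
    Integrable f (eulerFrobeniusPMFUnit n ρ h0 h1).toMeasure ∧
    ∫ k, f k ∂(eulerFrobeniusPMFUnit n ρ h0 h1).toMeasure =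
      ∑ k ∈ Finset.range (n + 1),
        ((eulerFrobeniusNumber n k ρ / (n.factorial : ℝ) : ℝ) : ℂ) * f k := by
  have hi : Integrable f (eulerFrobeniusPMFUnit n ρ h0 h1).toMeasure := by
    -- The support is finite, hence compact, and every function on a discrete space is continuous.
    rw [← PMF.restrict_toMeasure_support]
    have hs : (eulerFrobeniusPMFUnit n ρ h0 h1).support.Finite := by
      refine (Finset.range (n + 1)).finite_toSet.subset ?_
      rw [eulerFrobeniusPMFUnit, PMF.support_ofFinset]
      exact Set.inter_subset_left
    exact continuous_of_discreteTopology.continuousOn.integrableOn_compact hs.isCompact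
  refine ⟨hi, ?_⟩
  rw [PMF.integral_eq_tsum _ _ hi, tsum_eq_sum (s := Finset.range (n + 1))]
  · refine Finset.sum_congr rfl fun k _ => ?_
    rw [eulerFrobeniusPMFUnit, PMF.ofFinset_apply, ENNReal.toReal_ofReal, real_smul]
    exact div_nonneg (eulerFrobeniusNumber_nonneg n k h0 h1) (by positivity)
  · intro k hk
    rw [eulerFrobeniusPMFUnit, PMF.ofFinset_apply_of_notMem _ _ hk]
    simp

theorem integrable_and_integral_comp_of_hasLaw_eulerFrobeniusPMF (n : ℕ) (ρ : ℝ)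
    {Ω : Type*} [MeasurableSpace Ω] {P : Measure Ω} {Z : Ω → ℤ}
    (hZ : HasLaw Z (eulerFrobeniusPMF n ρ).toMeasure P) (f : ℤ → ℂ) :
    Integrable (fun ω => f (Z ω)) P ∧
    ∫ ω, f (Z ω) ∂P =
      ∑ k ∈ Finset.range (n + 1),
        ((eulerFrobeniusNumber n k (Int.fract ρ) / (n.factorial : ℝ) : ℝ) : ℂ)
          * f ((k : ℤ) - ⌊ρ⌋) := by
  obtain ⟨hi, he⟩ := integrable_and_integral_eulerFrobeniusPMFUnit n (Int.fract ρ)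
    (Int.fract_nonneg ρ) (Int.fract_lt_one ρ).le (fun k : ℕ => f ((k : ℤ) - ⌊ρ⌋))
  have hm : Measurable (fun k : ℕ => (k : ℤ) - ⌊ρ⌋) := measurable_of_countable _
  have hf : AEStronglyMeasurable f (eulerFrobeniusPMF n ρ).toMeasure :=
    (measurable_of_countable f).aestronglyMeasurable
  have hμ := PMF.toMeasure_map (p := eulerFrobeniusPMFUnit n (Int.fract ρ)
    (Int.fract_nonneg ρ) (Int.fract_lt_one ρ).le) (hf := hm)
  constructor
  · have : Integrable f (P.map Z) := by
      rw [hZ.map_eq, eulerFrobeniusPMF, ← hμ]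
      exact (integrable_map_measure (measurable_of_countable f).aestronglyMeasurable
        hm.aemeasurable).2 hi
    exact this.comp_aemeasurable hZ.aemeasurable
  · have := hZ.integral_comp hf
    rw [Function.comp_def] at this
    rw [this, ← he, eulerFrobeniusPMF, ← hμ, integral_map hm.aemeasurable
      (measurable_of_countable f).aestronglyMeasurable]

theorem aeval_eulerFrobeniusPoly (n : ℕ) (ρ : ℝ) (x : ℂ) :
    aeval x (eulerFrobeniusPoly ρ n) =
      ∑ k ∈ Finset.range (n + 1), (eulerFrobeniusNumber n k ρ : ℂ) * x ^ k := by
  have hd : (eulerFrobeniusPoly ρ n).natDegree < n + 1 :=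
    Nat.lt_succ_of_le (natDegree_le_iff_coeff_eq_zero.2
      fun k hk => eulerFrobeniusNumber_eq_zero n k ρ hk)
  rw [aeval_eq_sum_range' hd]
  simp [eulerFrobeniusNumber]

/-! ### Convergence and termwise differentiation of the series -/

theorem add_two_pi_mul_I_ne_zero {t : ℂ} (ht : exp t ≠ 1) (k : ℤ) :
    t + 2 * Real.pi * k * I ≠ 0 := by
  intro h
  apply ht
  rw [exp_eq_one_iff]
  exact ⟨-k, by push_cast; linear_combination h⟩

theorem norm_exp_neg_two_pi_I (k : ℤ) (ρ : ℝ) :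
    ‖exp (-(2 * Real.pi * I * k * ρ))‖ = 1 := by
  have : -(2 * Real.pi * I * k * ρ) = ((-(2 * Real.pi * k * ρ) : ℝ) : ℂ) * I := by
    push_cast; ring
  rw [this, norm_exp_ofReal_mul_I]

theorem norm_mgfTerm (n : ℕ) (ρ : ℝ) (t : ℂ) (k : ℤ) :
    ‖mgfTerm n ρ t k‖ = (‖t + 2 * Real.pi * k * I‖ ^ (n + 1))⁻¹ := by
  rw [mgfTerm, norm_div, norm_exp_neg_two_pi_I, norm_pow, one_div]

/-- Dividing by 2πi gives an Eisenstein-type series of exponent n + 1 ≥ 2. Poles need no exclusion: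
division by zero makes the singular term 0. -/
theorem summable_mgfTerm {n : ℕ} (hn : 1 ≤ n) (ρ : ℝ) (t : ℂ) : Summable (mgfTerm n ρ t) := by
  have hπ : (2 * Real.pi * I : ℂ) ≠ 0 := two_pi_I_ne_zero
  have h := (EisensteinSeries.linear_right_summable (t / (2 * Real.pi * I)) 1
    (k := (n : ℤ) + 1) (by omega)).norm.mul_left ((‖(2 * Real.pi * I : ℂ)‖ ^ (n + 1))⁻¹)
  refine Summable.of_norm (h.congr fun k => ?_)
  rw [norm_mgfTerm, norm_inv, norm_zpow, ← mul_inv]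
  norm_cast
  rw [← mul_pow, ← norm_mul]
  congr 3
  push_cast
  field_simp

/-- Local domination for termwise differentiation: moving t by less than half its distance to the
poles at most halves each |t + 2πik|. -/
theorem exists_ball_norm_mgfTerm_le (n : ℕ) (ρ : ℝ) {t : ℂ} (ht : exp t ≠ 1) :
    ∃ δ > 0, ∀ w ∈ Metric.ball t δ, exp w ≠ 1 ∧
      ∀ k, ‖mgfTerm n ρ w k‖ ≤ 2 ^ (n + 1) * ‖mgfTerm n ρ t k‖ := by
  have ho : IsOpen {w : ℂ | exp w ≠ 1} := isOpen_ne_fun continuous_exp continuous_const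
  obtain ⟨ε, hε, hb⟩ := Metric.isOpen_iff.1 ho t ht
  refine ⟨ε / 2, by positivity, fun w hw => ⟨hb (Metric.ball_subset_ball (by linarith) hw), ?_⟩⟩
  intro k
  -- Otherwise the pole -2πik would lie in the pole-free ball of radius ε.
  have h1 : ε ≤ ‖t + 2 * Real.pi * k * I‖ := by
    by_contra hlt
    have hm : (-(2 * Real.pi * k * I) : ℂ) ∈ Metric.ball t ε := by
      rw [Metric.mem_ball, dist_comm, dist_eq_norm, sub_neg_eq_add]
      exact not_le.1 hlt
    exact add_two_pi_mul_I_ne_zero (hb hm) k (by ring)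
  have h2 : ‖t + 2 * Real.pi * k * I‖ ≤ 2 * ‖w + 2 * Real.pi * k * I‖ := by
    have h3 := norm_sub_le (w + 2 * Real.pi * k * I) (w - t)
    rw [show w + 2 * Real.pi * k * I - (w - t) = t + 2 * Real.pi * k * I by ring] at h3
    rw [Metric.mem_ball, dist_eq_norm] at hw
    linarith
  have hpos : 0 < ‖t + 2 * Real.pi * k * I‖ := hε.trans_le h1
  rw [norm_mgfTerm, norm_mgfTerm]
  calc (‖w + 2 * Real.pi * k * I‖ ^ (n + 1))⁻¹
      ≤ ((‖t + 2 * Real.pi * k * I‖ / 2) ^ (n + 1))⁻¹ := by gcongr; linarith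
    _ = _ := by rw [div_pow, inv_div, div_eq_mul_inv]

theorem hasDerivAt_mgfTerm (n : ℕ) (ρ : ℝ) {t : ℂ} (ht : exp t ≠ 1) (k : ℤ) :
    HasDerivAt (fun w => mgfTerm n ρ w k) (-(n + 1) * mgfTerm (n + 1) ρ t k) t := by
  have h0 := add_two_pi_mul_I_ne_zero ht k
  have h := (((hasDerivAt_id t).add_const (2 * Real.pi * k * I : ℂ)).fun_pow (n + 1)).fun_inv
    (pow_ne_zero _ h0)
  refine ((h.const_mul (exp (-(2 * Real.pi * I * k * ρ)))).congr_deriv ?_).congr_of_eventuallyEq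
    (Eventually.of_forall fun w => ?_)
  · simp only [mgfTerm, id]
    generalize t + 2 * Real.pi * k * I = a at h0
    rw [add_tsub_cancel_right, ← pow_mul]
    push_cast
    field_simp
    ring
  · simp [mgfTerm, div_eq_mul_inv]

theorem deriv_tsum_mgfTerm {n : ℕ} (hn : 1 ≤ n) (ρ : ℝ) {t : ℂ} (ht : exp t ≠ 1) :
    deriv (fun w => ∑' k, mgfTerm n ρ w k) t = -(n + 1) * ∑' k, mgfTerm (n + 1) ρ t k := by
  obtain ⟨δ, hδ, hb⟩ := exists_ball_norm_mgfTerm_le n ρ ht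
  have h := Complex.hasSum_deriv_of_summable_norm (F := fun k w => mgfTerm n ρ w k)
    ((summable_mgfTerm hn ρ t).norm.mul_left (2 ^ (n + 1)))
    (fun k w hw => (hasDerivAt_mgfTerm n ρ (hb w hw).1 k).differentiableAt.differentiableWithinAt)
    Metric.isOpen_ball (fun k w hw => (hb w hw).2 k) (Metric.mem_ball_self hδ)
  rw [← h.tsum_eq, ← tsum_mul_left]
  exact tsum_congr fun k => (hasDerivAt_mgfTerm n ρ ht k).deriv

/-- With x = e^t, the numerator is (x - 1)(xP' + ρP) - (n + 1)xP, the negative of the recurrence for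
the next polynomial. -/
theorem hasDerivAt_aeval_eulerFrobeniusPoly (n : ℕ) (ρ : ℝ) {t : ℂ} (ht : exp t ≠ 1) :
    HasDerivAt (fun w => aeval (exp w) (eulerFrobeniusPoly ρ n) * exp (ρ * w)
        / (exp w - 1) ^ (n + 1))
      (-(aeval (exp t) (eulerFrobeniusPoly ρ (n + 1)) * exp (ρ * t)
        / (exp t - 1) ^ (n + 2))) t := by
  have h0 : exp t - 1 ≠ 0 := sub_ne_zero.2 ht
  have hP := ((eulerFrobeniusPoly ρ n).hasDerivAt_aeval (exp t)).comp t (hasDerivAt_exp t)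
  have hE := ((hasDerivAt_id t).const_mul (ρ : ℂ)).cexp
  have hD := ((hasDerivAt_exp t).sub_const 1).fun_pow (n + 1)
  refine ((hP.mul hE).div hD (pow_ne_zero _ h0)).congr_deriv ?_
  simp [eulerFrobeniusPoly]
  field_simp
  ring

/-! ### The case n = 1 by Fourier series -/

/-- Integration by parts; the 1/s boundary terms cancel because e^s = x. -/
theorem integral_linear_mul_exp {s x : ℂ} (hs : s ≠ 0) (hx : exp s = x) :
    ∫ v in (0 : ℝ)..1, (x + v * (1 - x)) * exp (s * v) = (x - 1) ^ 2 / s ^ 2 := by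
  have hd : ∀ v ∈ Set.uIcc (0 : ℝ) 1, HasDerivAt
      (fun v : ℝ => (x + v * (1 - x)) * exp (s * v) / s - (1 - x) * exp (s * v) / s ^ 2)
      ((x + v * (1 - x)) * exp (s * v)) v := by
    intro v _
    have hv := (hasDerivAt_id v).ofReal_comp
    have hl := (hv.mul_const (1 - x)).const_add x
    have he := (hv.const_mul s).cexp
    refine (((hl.mul he).div_const s).sub ((he.const_mul (1 - x)).div_const (s ^ 2))).congr_deriv ?_
    simp
    field_simp
    ring
  rw [intervalIntegral.integral_eq_sub_of_hasDerivAt hd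
    (by apply Continuous.intervalIntegrable; fun_prop)]
  simp [hx]
  field_simp
  ring

/-- The right-hand side, as a function of u extended with period 1, is continuous with summable
Fourier coefficients, so its Fourier series converges to it pointwise. -/
theorem tsum_mgfTerm_one {u : ℝ} (h0 : 0 ≤ u) (h1 : u < 1) {t : ℂ} (ht : exp t ≠ 1) :
    ∑' k, mgfTerm 1 u t k = (exp t + u * (1 - exp t)) * exp (u * t) / (exp t - 1) ^ 2 := by
  have hx : exp t - 1 ≠ 0 := sub_ne_zero.2 ht
  have : Fact ((0 : ℝ) < 1) := ⟨one_pos⟩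
  set g : ℝ → ℂ := fun v => (exp t + v * (1 - exp t)) * exp (v * t) / (exp t - 1) ^ 2 with hg
  have hgc : Continuous g := by fun_prop
  -- The endpoint values agree: g(0) = g(1) = e^t / (e^t - 1)².
  have hG : Continuous (AddCircle.liftIco 1 0 g) :=
    AddCircle.liftIco_zero_continuous (by simp [hg]) hgc.continuousOn
  have hc : ∀ k : ℤ, fourierCoeff (AddCircle.liftIco 1 0 g) k
      = 1 / (t + 2 * Real.pi * (-k : ℤ) * I) ^ 2 := by
    intro k
    have hs := add_two_pi_mul_I_ne_zero ht (-k)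
    have hes : exp (t + 2 * Real.pi * (-k : ℤ) * I) = exp t := by
      rw [exp_eq_exp_iff_exists_int]
      exact ⟨-k, by ring⟩
    rw [fourierCoeff_liftIco_eq, fourierCoeffOn_eq_integral]
    have : ∀ v : ℝ, fourier (-k) (v : AddCircle ((0 : ℝ) + 1 - 0)) • g v
        = ((exp t - 1) ^ 2)⁻¹ * ((exp t + v * (1 - exp t))
          * exp ((t + 2 * Real.pi * (-k : ℤ) * I) * v)) := by
      intro v
      rw [fourier_coe_apply, hg, add_mul _ _ (v : ℂ), exp_add]
      simp only [smul_eq_mul]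
      rw [show 2 * Real.pi * I * (-k : ℤ) * v / ((0 + 1 - 0 : ℝ) : ℂ)
        = 2 * Real.pi * (-k : ℤ) * I * v by push_cast; ring, mul_comm (v : ℂ) t]
      ring
    simp_rw [this]
    rw [intervalIntegral.integral_const_mul, zero_add, integral_linear_mul_exp hs hes]
    simp only [sub_zero, div_one, one_smul]
    field_simp
  let G : C(AddCircle (1 : ℝ), ℂ) := ⟨_, hG⟩
  have hterm : ∀ k : ℤ, fourierCoeff G k • fourier k (u : AddCircle (1 : ℝ))
      = mgfTerm 1 u t (-k) := by
    intro k
    change fourierCoeff (AddCircle.liftIco 1 0 g) k • _ = _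
    rw [hc, fourier_coe_apply, mgfTerm, smul_eq_mul, one_div, mul_comm, ← div_eq_mul_inv]
    congr 2
    push_cast
    ring
  have hsum : Summable (fourierCoeff G) := by
    refine Summable.of_norm (((summable_mgfTerm le_rfl u t).comp_injective
      neg_injective).norm.congr fun k => ?_)
    change _ = ‖fourierCoeff (AddCircle.liftIco 1 0 g) k‖
    rw [hc, Function.comp_apply, norm_mgfTerm, norm_div, norm_one, norm_pow, one_div]
  have h := has_pointwise_sum_fourier_series_of_summable hsum (u : AddCircle (1 : ℝ))
  simp_rw [hterm] at h
  have h2 : G (u : AddCircle (1 : ℝ)) = g u := by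
    change AddCircle.liftIco 1 0 g (u : AddCircle (1 : ℝ)) = g u
    exact AddCircle.liftIco_coe_apply ⟨h0, by simpa using h1⟩
  rw [h2] at h
  -- Fourier mode k is the series term of index -k.
  rw [← tsum_comp_neg, h.tsum_eq]

/-! ### Induction on n and passage to arbitrary ρ -/

theorem factorial_mul_tsum_mgfTerm {n : ℕ} (hn : 1 ≤ n) {u : ℝ} (h0 : 0 ≤ u) (h1 : u < 1)
    {t : ℂ} (ht : exp t ≠ 1) :
    (n.factorial : ℂ) * ∑' k, mgfTerm n u t k =
      aeval (exp t) (eulerFrobeniusPoly u n) * exp (u * t) / (exp t - 1) ^ (n + 1) := by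
  induction n, hn using Nat.le_induction generalizing t with
  | base =>
    rw [tsum_mgfTerm_one h0 h1 ht]
    simp [eulerFrobeniusPoly]
  | succ n hn ih =>
    -- The induction hypothesis holds on a neighbourhood of t, so the identity may be differentiated
    -- there.
    have ho : {w : ℂ | exp w ≠ 1} ∈ 𝓝 t :=
      (isOpen_ne_fun continuous_exp continuous_const).mem_nhds ht
    have he : (fun w => (n.factorial : ℂ) * ∑' k, mgfTerm n u w k) =ᶠ[𝓝 t]
        fun w => aeval (exp w) (eulerFrobeniusPoly u n) * exp (u * w) / (exp w - 1) ^ (n + 1) :=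
      eventually_of_mem ho fun w hw => ih hw
    have hd := he.deriv_eq
    rw [(hasDerivAt_aeval_eulerFrobeniusPoly n u ht).deriv, deriv_const_mul_field,
      deriv_tsum_mgfTerm hn u ht] at hd
    rw [Nat.factorial_succ]
    push_cast
    linear_combination -hd

theorem mgfTerm_fract (n : ℕ) (ρ : ℝ) (t : ℂ) : mgfTerm n (Int.fract ρ) t = mgfTerm n ρ t := by
  ext k
  unfold mgfTerm
  congr 1
  rw [exp_eq_exp_iff_exists_int]
  refine ⟨k * ⌊ρ⌋, ?_⟩
  rw [Int.fract]
  push_cast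
  ring

theorem mgfFormula_eq_sum {n : ℕ} (hn : 1 ≤ n) (ρ : ℝ) {t : ℂ} (ht : exp t ≠ 1) :
    mgfFormula n ρ t = ∑ k ∈ Finset.range (n + 1),
        ((eulerFrobeniusNumber n k (Int.fract ρ) / (n.factorial : ℝ) : ℝ) : ℂ)
          * exp (t * (((k : ℤ) - ⌊ρ⌋ : ℤ) : ℂ)) := by
  have h0 : exp t - 1 ≠ 0 := sub_ne_zero.2 ht
  have hf : (n.factorial : ℂ) ≠ 0 := by exact_mod_cast n.factorial_ne_zero
  have h := factorial_mul_tsum_mgfTerm hn (Int.fract_nonneg ρ) (Int.fract_lt_one ρ) ht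
  have hs : ∑' k, mgfTerm n ρ t k = aeval (exp t) (eulerFrobeniusPoly (Int.fract ρ) n)
      * exp (Int.fract ρ * t) / (exp t - 1) ^ (n + 1) / n.factorial := by
    rw [mgfTerm_fract] at h
    rw [← h, mul_div_cancel_left₀ _ hf]
  -- This leftover factor is the shift of the distribution by -⌊ρ⌋.
  have he : exp (-(ρ * t)) * exp (Int.fract ρ * t) = exp (-(t * ⌊ρ⌋)) := by
    rw [← exp_add, Int.fract]
    congr 1
    push_cast
    ring
  have hr : ∀ k : ℕ, exp (t * (((k : ℤ) - ⌊ρ⌋ : ℤ) : ℂ)) = exp (-(t * ⌊ρ⌋)) * exp t ^ k := by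
    intro k
    rw [← exp_nat_mul, ← exp_add]
    congr 1
    push_cast
    ring
  simp_rw [hr]
  calc mgfFormula n ρ t
      = (exp (-(ρ * t)) * exp (Int.fract ρ * t))
          * aeval (exp t) (eulerFrobeniusPoly (Int.fract ρ) n) / n.factorial := by
        rw [mgfFormula, hs]
        field_simp
    _ = _ := by
        rw [he, aeval_eulerFrobeniusPoly, Finset.mul_sum, Finset.sum_div]
        refine Finset.sum_congr rfl fun k _ => ?_
        push_cast
        ring

/-! ### Characteristic function and limits at the poles -/

theorem charFunTerm_eq (n : ℕ) (ρ : ℝ) (t : ℂ) (k : ℤ) :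
    charFunTerm n ρ t k = I ^ (n + 1) * mgfTerm n ρ (I * t) k := by
  have : I * t + 2 * Real.pi * k * I = I * (t + 2 * Real.pi * k) := by ring
  rw [charFunTerm, mgfTerm, this, mul_pow, ← mul_div_assoc,
    mul_div_mul_left _ _ (pow_ne_zero _ I_ne_zero)]

theorem charFunFormula_eq_mgfFormula (n : ℕ) (ρ : ℝ) (t : ℂ) :
    charFunFormula n ρ t = mgfFormula n ρ (I * t) := by
  have hI : (I : ℂ) ^ (n + 1) ≠ 0 := pow_ne_zero _ I_ne_zero
  simp_rw [charFunFormula, mgfFormula, charFunTerm_eq, tsum_mul_left]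
  rw [show I * ρ * t = ρ * (I * t) by ring]
  field_simp

theorem exp_ne_one_of_forall_ne {t : ℂ} (ht : ∀ m : ℤ, t ≠ 2 * Real.pi * m * I) : exp t ≠ 1 := by
  rw [Ne, exp_eq_one_iff]
  rintro ⟨m, hm⟩
  exact ht m (by rw [hm]; ring)

/-- The poles are isolated since the derivative of exp never vanishes. -/
theorem eventually_exp_ne_one (t : ℂ) : ∀ᶠ w in 𝓝[≠] t, exp w ≠ 1 :=
  (hasDerivAt_exp t).eventually_ne (exp_ne_zero t)

theorem mainTheorem5 (n : ℕ) (hn : 1 ≤ n) (ρ : ℝ)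
    {Ω : Type*} [MeasurableSpace Ω] (P : Measure Ω) (Z : Ω → ℤ)
    (hZ : HasLaw Z (eulerFrobeniusPMF n ρ).toMeasure P) :
    (∀ t : ℝ, (∀ m : ℤ, t ≠ 2 * Real.pi * m) →
      Summable (charFunTerm n ρ t) ∧
      charFun (P.map (fun ω => (Z ω : ℝ))) t = charFunFormula n ρ t) ∧
    (∀ m : ℤ, Tendsto (fun t : ℝ => charFunFormula n ρ t) (𝓝[≠] (2 * Real.pi * m))
      (𝓝 (charFun (P.map (fun ω => (Z ω : ℝ))) (2 * Real.pi * m)))) ∧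
    (∀ t : ℂ, Integrable (fun ω => exp (t * (Z ω : ℂ))) P) ∧
    (∀ t : ℂ, (∀ m : ℤ, t ≠ 2 * Real.pi * m * I) →
      Summable (mgfTerm n ρ t) ∧
      ∫ ω, exp (t * (Z ω : ℂ)) ∂P = mgfFormula n ρ t) ∧
    (∀ m : ℤ, Tendsto (mgfFormula n ρ) (𝓝[≠] (2 * Real.pi * m * I))
      (𝓝 (∫ ω, exp (2 * Real.pi * m * I * (Z ω : ℂ)) ∂P))) := by
  have hM := fun t : ℂ => integrable_and_integral_comp_of_hasLaw_eulerFrobeniusPMF n ρ hZ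
    (fun k : ℤ => exp (t * (k : ℂ)))
  have hmgf : ∀ t : ℂ, exp t ≠ 1 → ∫ ω, exp (t * (Z ω : ℂ)) ∂P = mgfFormula n ρ t := by
    intro t ht
    rw [mgfFormula_eq_sum hn ρ ht]
    exact (hM t).2
  have hcont : Continuous fun t : ℂ => ∫ ω, exp (t * (Z ω : ℂ)) ∂P := by
    rw [funext fun t => (hM t).2]
    fun_prop
  have hlim : ∀ t : ℂ,
      Tendsto (mgfFormula n ρ) (𝓝[≠] t) (𝓝 (∫ ω, exp (t * (Z ω : ℂ)) ∂P)) := by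
    intro t
    refine ((hcont.tendsto t).mono_left nhdsWithin_le_nhds).congr' ?_
    filter_upwards [eventually_exp_ne_one t] with w hw using hmgf w hw
  have hchar : ∀ t : ℝ, charFun (P.map (fun ω => (Z ω : ℝ))) t
      = ∫ ω, exp (I * t * (Z ω : ℂ)) ∂P := by
    intro t
    have hm : AEMeasurable (fun ω => (Z ω : ℝ)) P :=
      (measurable_of_countable (fun k : ℤ => (k : ℝ))).comp_aemeasurable hZ.aemeasurable
    rw [charFun_apply_real, integral_map hm (by fun_prop)]
    refine integral_congr_ae (Eventually.of_forall fun ω => ?_)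
    simp only [ofReal_intCast]
    congr 1
    ring
  refine ⟨fun t ht => ⟨?_, ?_⟩, fun m => ?_, fun t => (hM t).1, fun t ht =>
    ⟨summable_mgfTerm hn ρ t, hmgf t (exp_ne_one_of_forall_ne ht)⟩, fun m => hlim _⟩
  · exact ((summable_mgfTerm hn ρ (I * t)).mul_left (I ^ (n + 1))).congr
      fun k => (charFunTerm_eq n ρ t k).symm
  · rw [hchar, charFunFormula_eq_mgfFormula]
    refine hmgf _ (exp_ne_one_of_forall_ne fun m hm => ht m ?_)
    have : (t : ℂ) = ((2 * Real.pi * m : ℝ) : ℂ) := by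
      apply mul_left_cancel₀ I_ne_zero
      rw [hm]
      push_cast
      ring
    exact_mod_cast this
  · rw [hchar]
    simp_rw [charFunFormula_eq_mgfFormula]
    refine (hlim _).comp (tendsto_nhdsWithin_of_tendsto_nhds_of_eventually_within _ ?_ ?_)
    · refine (Continuous.tendsto ?_ _).mono_left nhdsWithin_le_nhds
      fun_prop
    · filter_upwards [self_mem_nhdsWithin] with t ht h
      exact ht (ofReal_injective (mul_left_cancel₀ I_ne_zero h))
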